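/- Let $p$ be an odd prime. Denote by $|\cdot|_p$ the absolute value on $\mathbb{C}_p$ with $|p|_p=1/p$, and by $v_p:\mathbb{C}_p^\times\to\mathbb{Q}$ the valuation with $|a|_p=p^{-v_p(a)}$. Fix an embedding into $\mathbb{C}_p$ of the field $\overline{\mathbb{Q}}\subset\mathbb{C}$ of algebraic numbers, and for $r\in\mathbb{Q}$ write $p^r\in\mathbb{C}_p^\times$ for the image of the positive real number $p^r$. For $a\in\mathbb{C}_p^\times$ let $\hat a$ be the unique root of unity of order not divisible by $p$ with $|a/p^{v_p(a)}-\hat a|_p<1$, and put $$\omega_v(a)=p^{v_p(a)}\hat a,\qquad \langle a\rangle=\frac{a}{\omega_v(a)},\qquad \langle a\rangle^{s}=\sum_{n=0}^\infty\binom{s}{n}(\langle a\rangle-1)^n$$ for those $s\in\mathbb{C}_p$ for which the series converges. The $p$-adic Hurwitz-type Euler zeta function is $$\zeta_{p,E}(s,a)=\int_{\mathbb{Z}_p}\langle a+t\rangle^{1-s}\,d\mu_{-1}(t),\qquad\text{where}\qquad \int_{\mathbb{Z}_p}g(t)\,d\mu_{-1}(t)=\lim_{r\to\infty}\sum_{k=0}^{p^r-1}g(k)(-1)^k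 .$$ The operator $T_p^a$ is defined by $$T_p^a[f](s)=\sum_{n=0}^\infty P_{p,n}^a(s)\,\exp_p(nD)f(s),\qquad \exp_p(nD)f(s)=\sum_{k=0}^\infty\frac{n^k}{k!}\frac{\partial^k f}{\partial s^k}(s),$$ where $P_{p,0}^a(s)=\frac{2}{s-1}$, $P_{p,1}^a(s)=\frac{1}{\omega_v(a)}$ and $P_{p,n}^a(s)=\frac{1}{n!\,\omega_v(a)^n}\prod_{j=1}^{n-1}(s-1+j)$ for $n\ge2$. Let $K\subset\mathbb{C}_p$ be a finite extension of $\mathbb{Q}_p$ with ramification index over $\mathbb{Q}_p$ less than $p-1$, let $a\in K$ with $|a|_p>1$, and let $s\in\mathbb{Z}_p$ with $s\neq1$. Put $f(z)=\zeta_{p,E}(z,a)-\langle a\rangle^{1-z}$. Then the series and the limit that define $f(z)$ converge for all $z\in\mathbb{C}_p$ in a neighbourhood of $s$, all derivatives of $f$ exist at $s$, for every $n\ge0$ the series $\exp_p(nD)f(s)$ converges $p$-adically, and the series $$T_p^a\left[\zeta_{p,E}(s,a)-\langle a\rangle^{1-s}\right]=\sum_{n=0}^\infty P_{p,n}^a(s)\exp_p(nD)\left[\zeta_{p,E}(s,a)-\langle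 a\rangle^{1-s}\right]$$ converges $p$-adically. -/

import Mathlib

open Filter Topology

noncomputable section

namespace PadicEuler

variable {p : ℕ} [Fact p.Prime]

/-- The positive real number `p ^ r`, `r` rational, is an algebraic number. -/
theorem isAlgebraic_rpow (p : ℕ) (r : ℚ) :
    IsAlgebraic ℚ (((p : ℝ) ^ (r : ℝ) : ℝ) : ℂ) := by
  have h : IsAlgebraic ℚ ((((p : ℝ) ^ (r : ℝ) : ℝ) : ℂ) ^ r.den) := by
    have e : ((((p : ℝ) ^ (r : ℝ) : ℝ) : ℂ) ^ r.den) = (algebraMap ℚ ℂ) ((p : ℚ) ^ r.num) := by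
      have e1 : ((p : ℝ) ^ (r : ℝ)) ^ r.den = (p : ℝ) ^ r.num := by
        rw [← Real.rpow_natCast, ← Real.rpow_mul (Nat.cast_nonneg p), ← Real.rpow_intCast]
        congr 1
        exact_mod_cast Rat.mul_den_eq_num r
      rw [← Complex.ofReal_pow, e1]
      simp
    rw [e]
    exact isAlgebraic_algebraMap _
  exact h.of_pow r.den_pos

/-- The power `p ^ r ∈ ℂ_p` for rational `r`: the image of the positive real number `p ^ r` under
a fixed embedding `ι` of the field `ℚ̄ ⊆ ℂ` of algebraic numbers into `ℂ_p`. -/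
def pPow (ι : algebraicClosure ℚ ℂ →+* ℂ_[p]) (r : ℚ) : ℂ_[p] :=
  ι ⟨(((p : ℝ) ^ (r : ℝ) : ℝ) : ℂ), mem_algebraicClosure_iff.mpr (isAlgebraic_rpow p r)⟩

open Classical in
/-- The valuation `v_p(a) ∈ ℚ` of `a ∈ ℂ_p`, `a ≠ 0`: the unique rational `r` with
`|a|_p = p ^ (-r)`. -/
def vp (a : ℂ_[p]) : ℚ :=
  if h : ∃ r : ℚ, ‖a‖ = (p : ℝ) ^ (-(r : ℝ)) then h.choose else 0

open Classical in
/-- The Teichmüller representative of `u ∈ ℂ_p`, `|u|_p = 1`: the unique root of unity `ζ` of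
order not divisible by `p` such that `|u - ζ|_p < 1`. -/
def teichmuller (u : ℂ_[p]) : ℂ_[p] :=
  if h : ∃ ζ : ℂ_[p], IsOfFinOrder ζ ∧ ¬ p ∣ orderOf ζ ∧ ‖u - ζ‖ < 1 then h.choose else 1

/-- `ω_v(a) = p ^ v_p(a) * â`, where `â` is the Teichmüller representative of
`a / p ^ v_p(a)`. -/
def omega (ι : algebraicClosure ℚ ℂ →+* ℂ_[p]) (a : ℂ_[p]) : ℂ_[p] :=
  pPow ι (vp a) * teichmuller (a / pPow ι (vp a))

/-- The projection `⟨a⟩ = p ^ (-v_p(a)) * a / â`. -/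
def angle (ι : algebraicClosure ℚ ℂ →+* ℂ_[p]) (a : ℂ_[p]) : ℂ_[p] :=
  a / omega ι a

/-- The `n`-th term `binom(s, n) * (⟨a⟩ - 1) ^ n` of the series defining `⟨a⟩ ^ s`. -/
def anglePowTerm (ι : algebraicClosure ℚ ℂ →+* ℂ_[p]) (a s : ℂ_[p]) (n : ℕ) : ℂ_[p] :=
  (∏ j ∈ Finset.range n, (s - (j : ℂ_[p]))) / (n.factorial : ℂ_[p]) * (angle ι a - 1) ^ n

/-- `⟨a⟩ ^ s`, where the series converges. -/
def anglePow (ι : algebraicClosure ℚ ℂ →+* ℂ_[p]) (a s : ℂ_[p]) : ℂ_[p] :=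
  ∑' n : ℕ, anglePowTerm ι a s n

/-- The inclusion `ℤ_p ⊆ ℂ_p`. -/
def ofZp (t : ℤ_[p]) : ℂ_[p] := algebraMap ℚ_[p] ℂ_[p] (t : ℚ_[p])

/-- The fermionic `p`-adic integral of `f` over `ℤ_p` exists and equals `I`. -/
def HasFermionicIntegral (f : ℤ_[p] → ℂ_[p]) (I : ℂ_[p]) : Prop :=
  Tendsto (fun r : ℕ => ∑ k ∈ Finset.range (p ^ r), f (k : ℤ_[p]) * (-1) ^ k) atTop (𝓝 I)

open Classical in
/-- The fermionic `p`-adic integral of `f` over `ℤ_p`, where it exists. -/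
def fermionicIntegral (f : ℤ_[p] → ℂ_[p]) : ℂ_[p] :=
  if h : ∃ I, HasFermionicIntegral f I then h.choose else 0

/-- The `p`-adic Hurwitz-type Euler zeta function
`ζ_{p,E}(s, a) = ∫_{ℤ_p} ⟨a + t⟩ ^ (1 - s) dμ₋₁(t)`. -/
def zeta (ι : algebraicClosure ℚ ℂ →+* ℂ_[p]) (s a : ℂ_[p]) : ℂ_[p] :=
  fermionicIntegral fun t : ℤ_[p] => anglePow ι (a + ofZp t) (1 - s)

/-- The defining expression of `ζ_{p,E}(s, a)` makes sense: the series for the integrand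
`⟨a + t⟩ ^ (1 - s)` converges for every `t ∈ ℤ_p`, and the integral exists. -/
def ZetaDefined (ι : algebraicClosure ℚ ℂ →+* ℂ_[p]) (s a : ℂ_[p]) : Prop :=
  (∀ t : ℤ_[p], Summable (anglePowTerm ι (a + ofZp t) (1 - s))) ∧
    ∃ I, HasFermionicIntegral (fun t : ℤ_[p] => anglePow ι (a + ofZp t) (1 - s)) I

/-- The coefficients `P_{p,n}^a(s)` of the `p`-adic Van Gorder operator. -/
def opCoeff (ι : algebraicClosure ℚ ℂ →+* ℂ_[p]) (a : ℂ_[p]) (n : ℕ) (s : ℂ_[p]) : ℂ_[p] :=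
  if n = 0 then 2 / (s - 1)
  else if n = 1 then 1 / omega ι a
  else 1 / ((n.factorial : ℂ_[p]) * omega ι a ^ n) *
    ∏ j ∈ Finset.Icc 1 (n - 1), (s - 1 + (j : ℂ_[p]))

/-- The `k`-th term `(n ^ k / k!) * D ^ k f (s)` of `exp_p(nD) f (s)`. -/
def expDTerm (n : ℕ) (f : ℂ_[p] → ℂ_[p]) (s : ℂ_[p]) (k : ℕ) : ℂ_[p] :=
  (n : ℂ_[p]) ^ k / (k.factorial : ℂ_[p]) * iteratedDeriv k f s

/-- `exp_p(nD) f (s)`, the sum of the Taylor series of `f` at `s` with increment `n`. -/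
def expD (n : ℕ) (f : ℂ_[p] → ℂ_[p]) (s : ℂ_[p]) : ℂ_[p] :=
  ∑' k : ℕ, expDTerm n f s k

/-- The value group `|K^×|_p` of a field `ℚ_p ⊆ K ⊆ ℂ_p`. -/
def valueGroup (K : IntermediateField ℚ_[p] ℂ_[p]) : Subgroup ℝˣ :=
  (Units.map (((normHom : ℂ_[p] →*₀ ℝ) : ℂ_[p] →* ℝ).comp (K.val : K →* ℂ_[p]))).range

/-- The ramification index `e(K/ℚ_p) = [|K^×|_p : |ℚ_p^×|_p]`. -/
def ramificationIndex (K : IntermediateField ℚ_[p] ℂ_[p]) : ℕ :=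
  (valueGroup (⊥ : IntermediateField ℚ_[p] ℂ_[p])).relIndex (valueGroup K)

end PadicEuler

end

namespace PadicEuler

variable {p : ℕ} [Fact p.Prime]

/-! Let `e` be the ramification index of `K`. An element of `K` of norm below `1` has norm `x` with
`x ^ e ≤ 1/p`; this applies to `a⁻¹`, and also to `⟨a⟩ - 1`, although `⟨a⟩` may lie outside `K`
(`omega_angle_spec`). Let `ρ` be the larger of `|⟨a⟩ - 1|` and `|ω_v(a)⁻¹|`. Since `e < p - 1`, `p *
ρ ^ (p - 1) < 1`, and Legendre's formula gives `ρ ^ n / |n!| ≤ θ ^ n` with `θ < 1`.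

For `t ∈ ℤ_p`, `⟨a + t⟩ = ⟨a⟩ + t / ω_v(a)`, so `G(t) = ⟨a + t⟩ - 1` is continuous with norm at most
`ρ`. The fermionic integral is a functional `L` of norm at most `1` on continuous functions.
Integrating the binomial series termwise gives `f(z) = ∑ (L(G ^ n) - G(0) ^ n) / n! * ∏_{j<n} (1 - z
- j)`, with coefficients bounded by `θ ^ n`.

Re-expansion at `s` yields a power series with geometrically decaying coefficients
(`exists_power_series`). Since `|n| ≤ 1`, the series `exp_p(nD) f(s)` converge and are bounded
uniformly in `n`, while `|P_{p,n}^a(s)| ≤ θ ^ n` for `n ≥ 1`. Hence the operator series converges.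
-/

/-! ### Norms on `ℂ_p` and powers of principal units -/

theorem norm_algebraMap_eq (x : ℚ_[p]) : ‖algebraMap ℚ_[p] ℂ_[p] x‖ = ‖x‖ :=
  norm_algebraMap' ℂ_[p] x

theorem norm_natCast_prime : ‖(p : ℂ_[p])‖ = (p : ℝ)⁻¹ := by
  rw [← map_natCast (algebraMap ℚ_[p] ℂ_[p]), norm_algebraMap_eq, Padic.norm_p]

theorem norm_natCast_le_one (n : ℕ) : ‖(n : ℂ_[p])‖ ≤ 1 := by
  rw [← map_natCast (algebraMap ℚ_[p] ℂ_[p]), norm_algebraMap_eq]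
  exact_mod_cast Padic.norm_int_le_one n

theorem norm_intCast_le_one (n : ℤ) : ‖(n : ℂ_[p])‖ ≤ 1 := by
  rw [← map_intCast (algebraMap ℚ_[p] ℂ_[p]), norm_algebraMap_eq]
  exact Padic.norm_int_le_one n

theorem norm_natCast_eq_one {n : ℕ} (h : ¬ p ∣ n) : ‖(n : ℂ_[p])‖ = 1 := by
  rw [← map_natCast (algebraMap ℚ_[p] ℂ_[p]), norm_algebraMap_eq]
  rw [Padic.norm_natCast_eq_one_iff]
  exact (Nat.Prime.coprime_iff_not_dvd Fact.out).2 h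

theorem norm_ofZp (t : ℤ_[p]) : ‖ofZp t‖ = ‖t‖ := by
  rw [ofZp, norm_algebraMap_eq]; rfl

theorem norm_ofZp_le_one (t : ℤ_[p]) : ‖ofZp t‖ ≤ 1 := by
  rw [norm_ofZp]; exact PadicInt.norm_le_one t

theorem continuous_ofZp : Continuous (ofZp : ℤ_[p] → ℂ_[p]) :=
  (continuous_algebraMap ℚ_[p] ℂ_[p]).comp continuous_subtype_val

theorem one_lt_prime_cast : (1 : ℝ) < p := by
  exact_mod_cast (Fact.out : p.Prime).one_lt

theorem norm_add_le_of_norm_le {x y : ℂ_[p]} {r : ℝ} (hx : ‖x‖ ≤ r) (hy : ‖y‖ ≤ r) : ‖x + y‖ ≤ r :=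
  (IsUltrametricDist.norm_add_le_max x y).trans (max_le hx hy)

theorem norm_sub_le_of_norm_le {x y : ℂ_[p]} {r : ℝ} (hx : ‖x‖ ≤ r) (hy : ‖y‖ ≤ r) : ‖x - y‖ ≤ r := by
  rw [sub_eq_add_neg]
  exact norm_add_le_of_norm_le hx (by rwa [norm_neg])

theorem norm_sub_lt_of_lt {x y : ℂ_[p]} {r : ℝ} (hx : ‖x‖ < r) (hy : ‖y‖ < r) : ‖x - y‖ < r := by
  rw [sub_eq_add_neg]
  exact (IsUltrametricDist.norm_add_le_max x (-y)).trans_lt (max_lt hx (by rwa [norm_neg]))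

theorem norm_eq_of_norm_sub_lt {x y : ℂ_[p]} (h : ‖x - y‖ < ‖y‖) : ‖x‖ = ‖y‖ := by
  have := IsUltrametricDist.norm_add_eq_max_of_norm_ne_norm (x := x - y) (y := y) h.ne
  rwa [sub_add_cancel, max_eq_right h.le] at this

theorem norm_aeval_int_le_one {x : ℂ_[p]} (hx : ‖x‖ ≤ 1) (q : Polynomial ℤ) :
    ‖Polynomial.aeval x q‖ ≤ 1 := by
  rw [Polynomial.aeval_eq_sum_range]
  refine IsUltrametricDist.norm_sum_le_of_forall_le_of_nonneg zero_le_one fun i _ => ?_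
  rw [zsmul_eq_mul, norm_mul, norm_pow]
  exact mul_le_one₀ (norm_intCast_le_one _) (by positivity) (pow_le_one₀ (norm_nonneg _) hx)

/-- Frobenius: `(x - 1) ^ p` and `x ^ p - 1` differ by `p` times an integral element. -/
theorem norm_sub_one_lt_of_pow_prime {x : ℂ_[p]} (hx : ‖x‖ ≤ 1) (h : ‖x ^ p - 1‖ < 1) :
    ‖x - 1‖ < 1 := by
  have hp : p.Prime := Fact.out
  obtain ⟨r, hr⟩ := exists_add_pow_prime_eq hp (Polynomial.X - 1 : Polynomial ℤ) 1
  have e := congrArg (Polynomial.aeval x) hr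
  simp only [sub_add_cancel, map_pow, map_add, map_mul, map_sub, map_one, Polynomial.aeval_X,
    map_natCast, one_pow] at e
  have e' : (x - 1) ^ p = (x ^ p - 1) -
      p * ((x - 1) * Polynomial.aeval x r) := by
    rw [e]; ring
  have h2 : ‖(p : ℂ_[p]) * ((x - 1) * Polynomial.aeval x r)‖ < 1 := by
    rw [norm_mul, norm_natCast_prime]
    have : ‖(x - 1) * Polynomial.aeval x r‖ ≤ 1 := by
      have := norm_aeval_int_le_one hx ((Polynomial.X - 1) * r)
      rwa [map_mul, map_sub, map_one, Polynomial.aeval_X] at this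
    calc _ ≤ (p : ℝ)⁻¹ * 1 := by gcongr
      _ < 1 := by rw [mul_one]; exact inv_lt_one_of_one_lt₀ one_lt_prime_cast
  have h3 : ‖x - 1‖ ^ p < 1 := by
    rw [← norm_pow, e']; exact norm_sub_lt_of_lt h h2
  by_contra! h4
  exact absurd (one_le_pow₀ h4) h3.not_ge

theorem norm_sub_one_lt_of_pow_prime_pow {x : ℂ_[p]} (hx : ‖x‖ ≤ 1) (k : ℕ)
    (h : ‖x ^ p ^ k - 1‖ < 1) : ‖x - 1‖ < 1 := by
  induction k with
  | zero => simpa using h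
  | succ k ih =>
    refine ih (norm_sub_one_lt_of_pow_prime ?_ ?_)
    · rw [norm_pow]; exact pow_le_one₀ (norm_nonneg _) hx
    · rwa [← pow_mul, ← pow_succ]

/-- The cofactor `1 + x + ⋯ + x ^ (m - 1)` is congruent to the unit `m` modulo the maximal ideal. -/
theorem norm_pow_sub_one {x : ℂ_[p]} (hx : ‖x - 1‖ < 1) {m : ℕ} (hm : ¬ p ∣ m) :
    ‖x ^ m - 1‖ = ‖x - 1‖ := by
  have hx1 : ‖x‖ = 1 := by
    simpa using norm_eq_of_norm_sub_lt (x := x) (y := 1) (by simpa using hx)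
  rw [← geom_sum_mul, norm_mul]
  have : ‖∑ i ∈ Finset.range m, x ^ i‖ = ‖(m : ℂ_[p])‖ := by
    refine norm_eq_of_norm_sub_lt ?_
    rw [norm_natCast_eq_one hm]
    have e : ∑ i ∈ Finset.range m, x ^ i - (m : ℂ_[p]) = ∑ i ∈ Finset.range m, (x ^ i - 1) := by
      simp
    rw [e]
    refine lt_of_le_of_lt (IsUltrametricDist.norm_sum_le_of_forall_le_of_nonneg
      (norm_nonneg (x - 1)) fun i _ => ?_) hx
    rw [← geom_sum_mul, norm_mul]
    refine mul_le_of_le_one_left (norm_nonneg _)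
      (IsUltrametricDist.norm_sum_le_of_forall_le_of_nonneg zero_le_one fun j _ => ?_)
    simp [hx1]
  rw [this, norm_natCast_eq_one hm, one_mul]

/-! ### Finite extensions: compactness, value group, Teichmüller representatives -/

theorem isCompact_mem_norm_le (K : IntermediateField ℚ_[p] ℂ_[p]) [FiniteDimensional ℚ_[p] K]
    (R : ℝ) : IsCompact {x : ℂ_[p] | x ∈ K ∧ ‖x‖ ≤ R} := by
  have : FiniteDimensional ℚ_[p] (Subalgebra.toSubmodule K.toSubalgebra) :=
    inferInstanceAs (FiniteDimensional ℚ_[p] K)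
  have : ProperSpace (Subalgebra.toSubmodule K.toSubalgebra) := FiniteDimensional.proper ℚ_[p] _
  convert (isCompact_closedBall (0 : Subalgebra.toSubmodule K.toSubalgebra) R).image
    continuous_subtype_val using 1
  ext x
  simp [and_comm]

/-- The norm is locally constant away from `0`, and the set is compact. -/
theorem finite_norms (K : IntermediateField ℚ_[p] ℂ_[p]) [FiniteDimensional ℚ_[p] K]
    (R : ℝ) : (norm '' {x : ℂ_[p] | (x ∈ K ∧ ‖x‖ ≤ R) ∧ 1 ≤ ‖x‖}).Finite := by
  have hc : IsCompact {x : ℂ_[p] | (x ∈ K ∧ ‖x‖ ≤ R) ∧ 1 ≤ ‖x‖} :=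
    (isCompact_mem_norm_le K R).inter_right (isClosed_le continuous_const continuous_norm)
  obtain ⟨T, hT, hcov⟩ := hc.elim_nhds_subcover (fun x => Metric.ball x ‖x‖) (fun x hx =>
    Metric.ball_mem_nhds x (by linarith [hx.2]))
  refine (T.finite_toSet.image norm).subset ?_
  rintro _ ⟨x, hx, rfl⟩
  obtain ⟨y, hy, hxy⟩ := Set.mem_iUnion₂.1 (hcov hx)
  rw [Metric.mem_ball, dist_eq_norm] at hxy
  exact ⟨y, hy, (norm_eq_of_norm_sub_lt hxy).symm⟩

theorem mem_valueGroup {K : IntermediateField ℚ_[p] ℂ_[p]} {u : ℝˣ} :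
    u ∈ valueGroup K ↔ ∃ x ∈ K, ‖x‖ = (u : ℝ) := by
  constructor
  · rintro ⟨x, rfl⟩
    exact ⟨(x : K), (x : K).2, rfl⟩
  · rintro ⟨x, hx, h⟩
    have hx0 : (⟨x, hx⟩ : K) ≠ 0 := by
      intro h0
      rw [Subtype.ext_iff] at h0
      apply u.ne_zero
      rw [← h, show x = 0 from h0, norm_zero]
    exact ⟨Units.mk0 ⟨x, hx⟩ hx0, Units.ext h⟩

theorem exists_zpow_of_mem_valueGroup_bot {u : ℝˣ}
    (hu : u ∈ valueGroup (⊥ : IntermediateField ℚ_[p] ℂ_[p])) : ∃ k : ℤ, (u : ℝ) = (p : ℝ) ^ k := by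
  obtain ⟨x, hx, h⟩ := mem_valueGroup.1 hu
  obtain ⟨y, rfl⟩ := IntermediateField.mem_bot.1 hx
  rw [norm_algebraMap_eq] at h
  have hy : y ≠ 0 := by
    rintro rfl
    exact u.ne_zero (by rw [← h, norm_zero])
  exact ⟨_, by rw [← h, Padic.norm_eq_zpow_neg_valuation hy]⟩

/-- `relIndex` takes the value `0` on infinite index, so finiteness has to be shown: multiplying by
a power of `p` moves every coset representative into `[1, p]`, where only finitely many norms occur.
-/
theorem ramificationIndex_ne_zero (K : IntermediateField ℚ_[p] ℂ_[p]) [FiniteDimensional ℚ_[p] K] :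
    ramificationIndex K ≠ 0 := by
  have hp1 : (1 : ℝ) < p := one_lt_prime_cast
  let S := {u : valueGroup K // 1 ≤ ((u : ℝˣ) : ℝ) ∧ ((u : ℝˣ) : ℝ) ≤ p}
  have hS : Finite S := by
    have : Finite (norm '' {x : ℂ_[p] | (x ∈ K ∧ ‖x‖ ≤ p) ∧ 1 ≤ ‖x‖}) := finite_norms K p
    refine Finite.of_injective (β := (norm '' {x : ℂ_[p] | (x ∈ K ∧ ‖x‖ ≤ p) ∧ 1 ≤ ‖x‖}))
      (fun u : S => ⟨((u.1 : ℝˣ) : ℝ), ?_⟩) ?_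
    · obtain ⟨x, hx, h⟩ := mem_valueGroup.1 u.1.2
      exact ⟨x, ⟨⟨hx, h ▸ u.2.2⟩, h ▸ u.2.1⟩, h⟩
    · intro u v huv
      exact Subtype.ext (Subtype.ext (Units.ext (congrArg Subtype.val huv)))
  have : Finite (valueGroup K ⧸
      (valueGroup (⊥ : IntermediateField ℚ_[p] ℂ_[p])).subgroupOf (valueGroup K)) := by
    refine Finite.of_surjective (fun u : S => QuotientGroup.mk u.1) ?_
    intro q
    obtain ⟨u, rfl⟩ := QuotientGroup.mk_surjective q
    obtain ⟨x, hx, hxu⟩ := mem_valueGroup.1 u.2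
    have hu0 : 0 < ‖x‖ := by
      rw [hxu]; exact lt_of_le_of_ne (hxu ▸ norm_nonneg x) (Units.ne_zero _).symm
    obtain ⟨k, hk1, hk2⟩ := exists_mem_Ico_zpow hu0 hp1
    have hp0 : (p : ℝ) ≠ 0 := by positivity
    have hcn : ‖(p : ℂ_[p]) ^ k‖ = (p : ℝ) ^ (-k) := by
      rw [norm_zpow, norm_natCast_prime, inv_zpow, zpow_neg]
    have hcm : Units.mk0 _ (zpow_ne_zero (-k) hp0) ∈
        valueGroup (⊥ : IntermediateField ℚ_[p] ℂ_[p]) :=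
      mem_valueGroup.2 ⟨(p : ℂ_[p]) ^ k, zpow_mem (natCast_mem _ p) k, hcn⟩
    have hcK : Units.mk0 _ (zpow_ne_zero (-k) hp0) ∈ valueGroup K :=
      mem_valueGroup.2 ⟨(p : ℂ_[p]) ^ k, zpow_mem (natCast_mem _ p) k, hcn⟩
    refine ⟨⟨u * ⟨_, hcK⟩, ?_, ?_⟩, ?_⟩
    · change 1 ≤ ((u : ℝˣ) : ℝ) * (p : ℝ) ^ (-k)
      rw [← hxu, zpow_neg, ← div_eq_mul_inv, le_div_iff₀ (by positivity), one_mul]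
      exact hk1
    · change ((u : ℝˣ) : ℝ) * (p : ℝ) ^ (-k) ≤ p
      rw [← hxu, zpow_neg, ← div_eq_mul_inv, div_le_iff₀ (by positivity)]
      rw [zpow_add_one₀ hp0, mul_comm] at hk2
      exact hk2.le
    · refine (QuotientGroup.eq.2 ?_).symm
      rw [inv_mul_cancel_left]
      exact hcm
  exact Subgroup.index_ne_zero_of_finite

theorem exists_norm_pow_ramificationIndex {K : IntermediateField ℚ_[p] ℂ_[p]} {x : ℂ_[p]}
    (hx : x ∈ K) (hx0 : x ≠ 0) : ∃ k : ℤ, ‖x‖ ^ ramificationIndex K = (p : ℝ) ^ k := by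
  have h := Subgroup.pow_relIndex_mem (valueGroup (⊥ : IntermediateField ℚ_[p] ℂ_[p]))
    (K := valueGroup K) (g := Units.mk0 ‖x‖ (norm_ne_zero_iff.2 hx0))
    (mem_valueGroup.2 ⟨x, hx, rfl⟩)
  obtain ⟨k, hk⟩ := exists_zpow_of_mem_valueGroup_bot h
  exact ⟨k, by rw [← hk, Units.val_pow_eq_pow_val]; rfl⟩

/-- The `e`-th power of a nonzero norm is an integral power of `p`; being below `1`, it is at most
`p⁻¹`. -/
theorem norm_pow_ramificationIndex_le {K : IntermediateField ℚ_[p] ℂ_[p]}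
    (hK : ramificationIndex K ≠ 0) {x : ℂ_[p]} (hx : x ∈ K) (h1 : ‖x‖ < 1) :
    ‖x‖ ^ ramificationIndex K ≤ (p : ℝ)⁻¹ := by
  rcases eq_or_ne x 0 with rfl | hx0
  · rw [norm_zero, zero_pow hK]; positivity
  obtain ⟨k, hk⟩ := exists_norm_pow_ramificationIndex hx hx0
  have h2 : (p : ℝ) ^ k < 1 := hk ▸ pow_lt_one₀ (norm_nonneg _) h1 hK
  have hp1 : (1 : ℝ) < p := one_lt_prime_cast
  have hk0 : k < 0 := by
    by_contra! h
    exact absurd (one_le_zpow₀ hp1.le h) h2.not_ge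
  rw [hk, ← zpow_neg_one]
  exact zpow_le_zpow_right₀ hp1.le (by omega)

/-- Some power of a unit of a finite extension, with exponent prime to `p`, is a principal unit. -/
theorem exists_norm_pow_sub_one_lt {K : IntermediateField ℚ_[p] ℂ_[p]}
    [FiniteDimensional ℚ_[p] K] {u : ℂ_[p]} (hu : u ∈ K) (h1 : ‖u‖ = 1) :
    ∃ N : ℕ, ¬ p ∣ N ∧ ‖u ^ N - 1‖ < 1 := by
  have hp : p.Prime := Fact.out
  have hex : ∃ M : ℕ, M ≠ 0 ∧ ‖u ^ M - 1‖ < 1 := by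
    -- By compactness two distinct powers of `u` are at distance less than `1`; dividing by the
    -- smaller power gives `M`.
    obtain ⟨x, -, φ, hφ, hlim⟩ := (isCompact_mem_norm_le K 1).tendsto_subseq
      (x := fun n : ℕ => u ^ n) (fun n => ⟨pow_mem hu n, by simp [h1]⟩)
    obtain ⟨n, hn⟩ := Metric.cauchySeq_iff'.1 hlim.cauchySeq 1 one_pos
    have h2 := hn (n + 1) (Nat.le_succ n)
    have hlt : φ n < φ (n + 1) := hφ (Nat.lt_succ_self n)
    refine ⟨φ (n + 1) - φ n, by omega, ?_⟩
    rw [dist_eq_norm] at h2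
    have e : u ^ φ (n + 1) - u ^ φ n = u ^ φ n * (u ^ (φ (n + 1) - φ n) - 1) := by
      rw [mul_sub, ← pow_add, Nat.add_sub_cancel' hlt.le, mul_one]
    simp only [Function.comp_apply] at h2
    rwa [e, norm_mul, norm_pow, h1, one_pow, one_mul] at h2
  obtain ⟨M, hM, h2⟩ := hex
  obtain ⟨k, N, hN, rfl⟩ := Nat.exists_eq_pow_mul_and_not_dvd hM p hp.ne_one
  refine ⟨N, hN, norm_sub_one_lt_of_pow_prime_pow (by simp [h1]) k ?_⟩
  rwa [← pow_mul, mul_comm]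

/-- The Teichmüller representative exists if some power with exponent prime to `p` is a
principal unit. -/
theorem exists_root_of_unity {u : ℂ_[p]} {N : ℕ} (hN : ¬ p ∣ N) (h : ‖u ^ N - 1‖ < 1) :
    ∃ ζ : ℂ_[p], IsOfFinOrder ζ ∧ ¬ p ∣ orderOf ζ ∧ ‖u - ζ‖ < 1 := by
  have hN0 : 0 < N := Nat.pos_of_ne_zero (by rintro rfl; exact hN (dvd_zero p))
  have hs := IsAlgClosed.splits (Polynomial.X ^ N - 1 : Polynomial ℂ_[p])
  have hm : (Polynomial.X ^ N - 1 : Polynomial ℂ_[p]).Monic :=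
    Polynomial.monic_X_pow_sub_C 1 hN0.ne'
  have e := congrArg (Polynomial.eval u) (hs.eq_prod_roots_of_monic hm)
  simp only [Polynomial.eval_sub, Polynomial.eval_pow, Polynomial.eval_X, Polynomial.eval_one,
    Polynomial.eval_multiset_prod, Multiset.map_map, Function.comp_def, Polynomial.eval_C] at e
  -- `u ^ N - 1` is the product of the `u - ζ` over the roots, so not all factors can have norm at
  -- least `1`.
  have : ∃ ζ ∈ (Polynomial.X ^ N - 1 : Polynomial ℂ_[p]).roots, ‖u - ζ‖ < 1 := by
    by_contra! hc
    refine absurd h (not_lt.2 ?_)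
    rw [e]
    generalize (Polynomial.X ^ N - 1 : Polynomial ℂ_[p]).roots = s at hc
    induction s using Multiset.induction_on with
    | empty => simp
    | cons x s ih =>
      rw [Multiset.map_cons, Multiset.prod_cons, norm_mul]
      exact one_le_mul_of_one_le_of_one_le (hc x (Multiset.mem_cons_self x s))
        (ih fun ζ hζ => hc ζ (Multiset.mem_cons_of_mem hζ))
  obtain ⟨ζ, hζ, hlt⟩ := this
  have hζ1 : ζ ^ N = 1 := by
    have := (Polynomial.mem_roots'.1 hζ).2
    simpa [sub_eq_zero] using this
  exact ⟨ζ, isOfFinOrder_iff_pow_eq_one.2 ⟨N, hN0, hζ1⟩,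
    fun hd => hN (hd.trans (orderOf_dvd_of_pow_eq_one hζ1)), hlt⟩

/-! ### The valuation, `ω_v` and `⟨·⟩` -/

section

variable (ι : algebraicClosure ℚ ℂ →+* ℂ_[p])

theorem pPow_pow {r : ℚ} {n : ℕ} {m : ℤ} (h : r * n = m) : pPow ι r ^ n = (p : ℂ_[p]) ^ m := by
  have e : (⟨(((p : ℝ) ^ (r : ℝ) : ℝ) : ℂ),
      mem_algebraicClosure_iff.mpr (isAlgebraic_rpow p r)⟩ : algebraicClosure ℚ ℂ) ^ n =
      (p : algebraicClosure ℚ ℂ) ^ m := by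
    apply Subtype.ext
    have e1 : ((p : ℝ) ^ (r : ℝ)) ^ n = (p : ℝ) ^ m := by
      rw [← Real.rpow_natCast, ← Real.rpow_mul (Nat.cast_nonneg p), ← Real.rpow_intCast]
      congr 1
      exact_mod_cast h
    have e2 : ((((p : ℝ) ^ (r : ℝ) : ℝ) : ℂ)) ^ n = (p : ℂ) ^ m := by
      rw [← Complex.ofReal_pow, e1]; simp
    rw [SubmonoidClass.coe_pow, e2]
    exact (map_zpow₀ (algebraMap (algebraicClosure ℚ ℂ) ℂ) (p : algebraicClosure ℚ ℂ) m).symm ▸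
      congrArg (· ^ m) (map_natCast (algebraMap (algebraicClosure ℚ ℂ) ℂ) p).symm
  rw [pPow, ← map_pow, e, map_zpow₀, map_natCast]

theorem norm_pPow (r : ℚ) : ‖pPow ι r‖ = (p : ℝ) ^ (-(r : ℝ)) := by
  have hp0 : (0 : ℝ) ≤ p := Nat.cast_nonneg p
  refine (pow_left_inj₀ (norm_nonneg _) (Real.rpow_nonneg hp0 _) r.den_nz).1 ?_
  rw [← norm_pow, pPow_pow ι (Rat.mul_den_eq_num r), norm_zpow, norm_natCast_prime,
    ← Real.rpow_natCast, ← Real.rpow_mul hp0, inv_zpow, ← zpow_neg, ← Real.rpow_intCast]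
  congr 1
  have := Rat.mul_den_eq_num r
  push_cast
  have h : (r : ℝ) * r.den = r.num := by exact_mod_cast this
  rw [neg_mul, h]

theorem pPow_ne_zero (r : ℚ) : pPow ι r ≠ 0 := by
  rw [← norm_ne_zero_iff, norm_pPow]
  have : (1 : ℝ) < p := one_lt_prime_cast
  positivity

theorem vp_spec {a : ℂ_[p]} {e : ℕ} (he : e ≠ 0) {k : ℤ} (h : ‖a‖ ^ e = (p : ℝ) ^ k) :
    ‖a‖ = (p : ℝ) ^ (-(vp a : ℝ)) ∧ vp a * e = (-k : ℤ) := by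
  have hp1 : (1 : ℝ) < p := one_lt_prime_cast
  have hp0 : (0 : ℝ) ≤ p := Nat.cast_nonneg p
  have hex : ∃ r : ℚ, ‖a‖ = (p : ℝ) ^ (-(r : ℝ)) := by
    refine ⟨-(k / e), (pow_left_inj₀ (norm_nonneg _) (Real.rpow_nonneg hp0 _) he).1 ?_⟩
    rw [h, ← Real.rpow_natCast, ← Real.rpow_mul hp0, ← Real.rpow_intCast]
    congr 1
    push_cast
    field_simp
  have h1 : ‖a‖ = (p : ℝ) ^ (-(vp a : ℝ)) := by
    rw [vp, dif_pos hex]; exact hex.choose_spec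
  refine ⟨h1, ?_⟩
  rw [h1, ← Real.rpow_natCast, ← Real.rpow_mul hp0, ← Real.rpow_intCast] at h
  have h2 := (Real.rpow_right_inj (by linarith) hp1.ne').1 h
  have h3 : (vp a : ℝ) * e = ((-k : ℤ) : ℝ) := by
    push_cast
    linarith
  exact_mod_cast h3

theorem vp_congr {a b : ℂ_[p]} (h : ‖a‖ = ‖b‖) : vp a = vp b := by
  unfold vp
  rw [h]

theorem teichmuller_congr {u v : ℂ_[p]} (h : ‖u - v‖ < 1) : teichmuller u = teichmuller v := by
  have : (fun ζ : ℂ_[p] => IsOfFinOrder ζ ∧ ¬ p ∣ orderOf ζ ∧ ‖u - ζ‖ < 1) =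
      fun ζ : ℂ_[p] => IsOfFinOrder ζ ∧ ¬ p ∣ orderOf ζ ∧ ‖v - ζ‖ < 1 := by
    funext ζ
    have : ‖u - ζ‖ < 1 ↔ ‖v - ζ‖ < 1 := by
      constructor <;> intro h'
      · have := norm_sub_lt_of_lt h' h
        rwa [sub_sub_sub_cancel_left, ← neg_sub, neg_sub] at this
      · rw [norm_sub_rev] at h
        have := norm_sub_lt_of_lt h' h
        rwa [sub_sub_sub_cancel_left, ← neg_sub, neg_sub] at this
    rw [this]
  -- The two defining predicates are equal, so the choice returns the same root; uniqueness of the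
  -- root is not needed.
  classical exact congrArg (fun Q : ℂ_[p] → Prop => if h : ∃ ζ, Q ζ then h.choose else 1) this

theorem teichmuller_spec {u : ℂ_[p]} {N : ℕ} (hN : ¬ p ∣ N) (h : ‖u ^ N - 1‖ < 1) :
    IsOfFinOrder (teichmuller u) ∧ ¬ p ∣ orderOf (teichmuller u) ∧ ‖u - teichmuller u‖ < 1 := by
  have hex := exists_root_of_unity hN h
  rw [teichmuller, dif_pos hex]
  exact hex.choose_spec

/-- Adding `t` changes neither the norm of `a` nor the residue class of `a / p ^ v_p(a)`. -/
theorem omega_add {a t : ℂ_[p]} {e : ℕ} (he : e ≠ 0) {k : ℤ} (h : ‖a‖ ^ e = (p : ℝ) ^ k)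
    (ht : ‖t‖ < ‖a‖) : omega ι (a + t) = omega ι a := by
  have hn : ‖a + t‖ = ‖a‖ := norm_eq_of_norm_sub_lt (by rwa [add_sub_cancel_left])
  rw [omega, omega, vp_congr hn]
  congr 1
  refine teichmuller_congr ?_
  have hpa : ‖pPow ι (vp a)‖ = ‖a‖ := by rw [norm_pPow, (vp_spec he h).1]
  rw [← sub_div, add_sub_cancel_left, norm_div, hpa]
  exact (div_lt_one ((norm_nonneg _).trans_lt ht)).2 ht

/-- The basic estimate for `⟨a⟩` in a finite extension of small ramification. -/
theorem omega_angle_spec {K : IntermediateField ℚ_[p] ℂ_[p]} [FiniteDimensional ℚ_[p] K]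
    (hK : ramificationIndex K < p) {a : ℂ_[p]} (ha : a ∈ K) (ha0 : a ≠ 0) :
    ‖omega ι a‖ = ‖a‖ ∧ ‖angle ι a - 1‖ < 1 ∧
      ‖angle ι a - 1‖ ^ ramificationIndex K ≤ (p : ℝ)⁻¹ := by
  have hp : p.Prime := Fact.out
  have he := ramificationIndex_ne_zero K
  set e := ramificationIndex K with he_def
  obtain ⟨k, hk⟩ := exists_norm_pow_ramificationIndex ha ha0
  obtain ⟨hv, hvk⟩ := vp_spec he hk
  have hpp := pPow_pow ι hvk
  set P := pPow ι (vp a) with hP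
  have hPa : ‖P‖ = ‖a‖ := by rw [hP, norm_pPow, hv]
  have hu1 : ‖a / P‖ = 1 := by rw [norm_div, hPa, div_self (norm_ne_zero_iff.2 ha0)]
  have hpe : ¬ p ∣ e := fun h => absurd (Nat.le_of_dvd (Nat.pos_of_ne_zero he) h) hK.not_ge
  -- `P` itself may lie outside `K`, but `P ^ e` is an integral power of `p`.
  have hPe : P ^ e ∈ K := by rw [hpp]; exact zpow_mem (natCast_mem _ p) _
  have hue : (a / P) ^ e ∈ K := by rw [div_pow]; exact div_mem (pow_mem ha e) hPe
  obtain ⟨N, hN, hN1⟩ := exists_norm_pow_sub_one_lt hue (by rw [norm_pow, hu1, one_pow])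
  rw [← pow_mul] at hN1
  obtain ⟨hfin, hord, hlt⟩ := teichmuller_spec
    (fun h => (hp.dvd_mul.1 h).elim hpe hN) hN1
  set ζ := teichmuller (a / P) with hζ
  set M := orderOf ζ with hM
  have hζM : ζ ^ M = 1 := pow_orderOf_eq_one ζ
  have hM0 : 0 < M := hfin.orderOf_pos
  have hζ1 : ‖ζ‖ = 1 := by
    refine (pow_eq_one_iff_of_nonneg (norm_nonneg _) hM0.ne').1 ?_
    rw [← norm_pow, hζM, norm_one]
  have hζ0 : ζ ≠ 0 := by rw [← norm_ne_zero_iff, hζ1]; exact one_ne_zero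
  have ho : omega ι a = P * ζ := rfl
  have hang : angle ι a = a / P / ζ := by rw [angle, ho, div_div]
  have h1 : ‖angle ι a - 1‖ < 1 := by
    rw [hang, div_sub_one hζ0, norm_div, hζ1, div_one]
    exact hlt
  refine ⟨by rw [ho, norm_mul, hζ1, mul_one, hPa], h1, ?_⟩
  -- The exponent `e * M` brings `⟨a⟩` into `K` by killing `ζ` and the fractional power of `p`;
  -- being prime to `p`, it preserves the distance to `1`.
  have hm : ¬ p ∣ e * M := fun h => (hp.dvd_mul.1 h).elim hpe hord
  have hmem : angle ι a ^ (e * M) - 1 ∈ K := by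
    refine sub_mem ?_ (one_mem K)
    have : angle ι a ^ (e * M) = ((a / P) ^ e) ^ M := by
      rw [hang, div_pow, mul_comm e M, pow_mul ζ, hζM, one_pow, div_one, mul_comm M e, pow_mul]
    rw [this]
    exact pow_mem hue M
  have h2 := norm_pow_sub_one h1 hm
  rw [← h2] at h1
  rw [← h2]
  exact norm_pow_ramificationIndex_le he hmem h1

theorem angle_add {a t : ℂ_[p]} {e : ℕ} (he : e ≠ 0) {k : ℤ} (h : ‖a‖ ^ e = (p : ℝ) ^ k)
    (ht : ‖t‖ < ‖a‖) : angle ι (a + t) = angle ι a + t / omega ι a := by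
  rw [angle, omega_add ι he h ht, add_div, angle]

end

/-! ### Factorial growth -/

theorem exists_pow_div_norm_factorial_le {ρ : ℝ} (h0 : 0 ≤ ρ) (h : p * ρ ^ (p - 1) < 1) :
    ∃ θ : ℝ, 0 ≤ θ ∧ θ < 1 ∧ ∀ n : ℕ, ρ ^ n / ‖(n.factorial : ℂ_[p])‖ ≤ θ ^ n := by
  have hp : p.Prime := Fact.out
  have hp1 : p - 1 ≠ 0 := by have := hp.two_le; omega
  have hpos : (0 : ℝ) < p := by exact_mod_cast hp.pos
  have hb : (0 : ℝ) ≤ p * ρ ^ (p - 1) := by positivity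
  -- `θ = p ^ (1 / (p - 1)) * ρ`. After raising to the power `p - 1`, the claim follows from
  -- Legendre's bound `(p - 1) * v_p(n!) ≤ n`.
  refine ⟨(p * ρ ^ (p - 1)) ^ ((p - 1 : ℕ) : ℝ)⁻¹, Real.rpow_nonneg hb _,
    Real.rpow_lt_one hb h (by positivity), fun n => ?_⟩
  have hf0 : (n.factorial : ℂ_[p]) ≠ 0 := by exact_mod_cast n.factorial_ne_zero
  refine (pow_le_pow_iff_left₀ (by positivity) (by positivity) hp1).1 ?_
  rw [← pow_mul, mul_comm n, pow_mul, Real.rpow_inv_natCast_pow hb hp1, div_pow, mul_pow,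
    ← pow_mul, mul_comm n, pow_mul, div_le_iff₀ (by positivity)]
  have hfn : ‖(n.factorial : ℂ_[p])‖ = (p : ℝ) ^ (-(padicValNat p n.factorial : ℤ)) := by
    rw [← map_natCast (algebraMap ℚ_[p] ℂ_[p]), norm_algebraMap_eq,
      Padic.norm_eq_zpow_neg_valuation (by exact_mod_cast n.factorial_ne_zero),
      Padic.valuation_natCast]
  have hle : (p - 1) * padicValNat p n.factorial ≤ n := by
    rw [sub_one_mul_padicValNat_factorial]; omega
  have hone : 1 ≤ (p : ℝ) ^ n * ‖(n.factorial : ℂ_[p])‖ ^ (p - 1) := by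
    rw [hfn, zpow_neg, zpow_natCast, inv_pow, ← pow_mul, mul_comm _ (p - 1), ← div_eq_mul_inv,
      one_le_div (by positivity)]
    exact pow_le_pow_right₀ (by exact_mod_cast hp.one_le) hle
  calc (ρ ^ (p - 1)) ^ n = 1 * (ρ ^ (p - 1)) ^ n := (one_mul _).symm
    _ ≤ (p : ℝ) ^ n * ‖(n.factorial : ℂ_[p])‖ ^ (p - 1) * (ρ ^ (p - 1)) ^ n := by gcongr
    _ = _ := by ring

/-! ### The fermionic integral -/

theorem sum_neg_one_pow_range_odd {R : Type*} [Ring R] {m : ℕ} (hm : Odd m) :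
    ∑ j ∈ Finset.range m, (-1 : R) ^ j = 1 := by
  rw [neg_one_geom_sum, if_neg (Nat.not_even_iff_odd.2 hm)]

theorem sum_range_mul {R : Type*} [AddCommMonoid R] (m n : ℕ) (g : ℕ → R) :
    ∑ k ∈ Finset.range (m * n), g k =
      ∑ k ∈ Finset.range m, ∑ j ∈ Finset.range n, g (k + j * m) := by
  rw [Finset.sum_comm]
  induction n with
  | zero => simp
  | succ n ih =>
    rw [Nat.mul_succ, Finset.sum_range_add, ih, Finset.sum_range_succ]
    congr 1
    refine Finset.sum_congr rfl fun k _ => ?_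
    rw [add_comm, mul_comm]

/-- The partial sums defining the fermionic integral. -/
noncomputable def fermionicSum (g : ℤ_[p] → ℂ_[p]) (r : ℕ) : ℂ_[p] :=
  ∑ k ∈ Finset.range (p ^ r), g (k : ℤ_[p]) * (-1) ^ k

theorem norm_fermionicSum_le {g : ℤ_[p] → ℂ_[p]} {C : ℝ} (hC : 0 ≤ C) (h : ∀ t, ‖g t‖ ≤ C)
    (r : ℕ) : ‖fermionicSum g r‖ ≤ C := by
  refine IsUltrametricDist.norm_sum_le_of_forall_le_of_nonneg hC fun k _ => ?_
  rw [norm_mul, norm_pow, norm_neg, norm_one, one_pow, mul_one]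
  exact h _

/-- Indices below `p ^ (r + 1)` are written `k + j * p ^ r`. As `p` is odd, the sign splits as `(-1)
^ j * (-1) ^ k`, and the `p` signs `(-1) ^ j` sum to `1`, which allows `g k` to be subtracted in
every term. -/
theorem fermionicSum_succ_sub (hp2 : p ≠ 2) (g : ℤ_[p] → ℂ_[p]) (r : ℕ) :
    fermionicSum g (r + 1) - fermionicSum g r =
      ∑ k ∈ Finset.range (p ^ r), ∑ j ∈ Finset.range p,
        (g (k + j * p ^ r) - g k) * (-1) ^ j * (-1) ^ k := by
  have hodd : Odd p := (Fact.out : p.Prime).odd_of_ne_two hp2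
  rw [fermionicSum, fermionicSum, pow_succ, sum_range_mul, ← Finset.sum_sub_distrib]
  refine Finset.sum_congr rfl fun k _ => ?_
  simp_rw [sub_mul, Finset.sum_sub_distrib, mul_assoc, ← Finset.mul_sum, ← Finset.sum_mul,
    sum_neg_one_pow_range_odd hodd, one_mul]
  congr 1
  refine Finset.sum_congr rfl fun j _ => ?_
  rw [pow_add, mul_comm j, pow_mul, hodd.pow.neg_one_pow, mul_comm ((-1 : ℂ_[p]) ^ k)]
  push_cast
  rw [mul_comm (j : ℤ_[p])]

theorem exists_hasFermionicIntegral (hp2 : p ≠ 2) {g : ℤ_[p] → ℂ_[p]} (hg : Continuous g) :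
    ∃ I, HasFermionicIntegral g I := by
  have hp1 : (1 : ℝ) < p := one_lt_prime_cast
  refine cauchySeq_tendsto_of_complete (u := fermionicSum g) ?_
  -- In an ultrametric space consecutive differences tending to `0` suffice; uniform continuity of
  -- `g` makes them small.
  refine NonarchimedeanAddGroup.cauchySeq_of_tendsto_sub_nhds_zero ?_
  rw [tendsto_zero_iff_norm_tendsto_zero, Metric.tendsto_atTop]
  intro ε hε
  obtain ⟨δ, hδ, hu⟩ := Metric.uniformContinuous_iff.1
    (CompactSpace.uniformContinuous_of_continuous hg) (ε / 2) (half_pos hε)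
  obtain ⟨r₀, hr₀⟩ := exists_pow_lt_of_lt_one hδ (inv_lt_one_of_one_lt₀ hp1)
  refine ⟨r₀, fun r hr => ?_⟩
  rw [dist_zero_right, norm_norm, fermionicSum_succ_sub hp2]
  refine lt_of_le_of_lt ?_ (half_lt_self hε)
  refine IsUltrametricDist.norm_sum_le_of_forall_le_of_nonneg (half_pos hε).le fun k _ =>
    IsUltrametricDist.norm_sum_le_of_forall_le_of_nonneg (half_pos hε).le fun j _ => ?_
  rw [norm_mul, norm_mul, norm_pow, norm_pow, norm_neg, norm_one, one_pow, one_pow, mul_one,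
    mul_one, ← dist_eq_norm]
  refine (hu ?_).le
  rw [dist_eq_norm, add_sub_cancel_left, norm_mul, norm_pow, PadicInt.norm_p]
  calc ‖(j : ℤ_[p])‖ * (p : ℝ)⁻¹ ^ r ≤ 1 * (p : ℝ)⁻¹ ^ r₀ := by
        gcongr ?_ * ?_
        · exact PadicInt.norm_le_one _
        · exact pow_le_pow_of_le_one (by positivity) (inv_le_one_of_one_le₀ hp1.le) hr
    _ < δ := by rwa [one_mul]

theorem HasFermionicIntegral.fermionicIntegral_eq {g : ℤ_[p] → ℂ_[p]} {I : ℂ_[p]}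
    (h : HasFermionicIntegral g I) : fermionicIntegral g = I := by
  have hex : ∃ I, HasFermionicIntegral g I := ⟨I, h⟩
  rw [fermionicIntegral, dif_pos hex]
  exact tendsto_nhds_unique hex.choose_spec h

theorem hasFermionicIntegral_of_continuous (hp2 : p ≠ 2) {g : ℤ_[p] → ℂ_[p]} (hg : Continuous g) :
    HasFermionicIntegral g (fermionicIntegral g) := by
  obtain ⟨I, hI⟩ := exists_hasFermionicIntegral hp2 hg
  rwa [hI.fermionicIntegral_eq]

/-- The fermionic integral as a bounded functional on the continuous functions. -/
noncomputable def fermionicCLM (hp2 : p ≠ 2) : C(ℤ_[p], ℂ_[p]) →L[ℂ_[p]] ℂ_[p] :=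
  LinearMap.mkContinuous
    { toFun := fun g => fermionicIntegral g
      map_add' := fun g h => by
        refine HasFermionicIntegral.fermionicIntegral_eq ?_
        refine ((hasFermionicIntegral_of_continuous hp2 g.continuous).add
          (hasFermionicIntegral_of_continuous hp2 h.continuous)).congr fun r => ?_
        rw [← Finset.sum_add_distrib]
        exact Finset.sum_congr rfl fun k _ => (add_mul _ _ _).symm
      map_smul' := fun c g => by
        refine HasFermionicIntegral.fermionicIntegral_eq ?_
        refine ((hasFermionicIntegral_of_continuous hp2 g.continuous).const_mul c).congr
          fun r => ?_
        rw [Finset.mul_sum]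
        exact Finset.sum_congr rfl fun k _ => (mul_assoc _ _ _).symm }
    1 fun g => by
      rw [one_mul]
      exact le_of_tendsto (hasFermionicIntegral_of_continuous hp2 g.continuous).norm
        (Eventually.of_forall (norm_fermionicSum_le (norm_nonneg g) g.norm_coe_le_norm))

theorem fermionicCLM_apply (hp2 : p ≠ 2) (g : C(ℤ_[p], ℂ_[p])) :
    fermionicCLM hp2 g = fermionicIntegral g := rfl

theorem norm_fermionicCLM_apply_le (hp2 : p ≠ 2) (g : C(ℤ_[p], ℂ_[p])) :
    ‖fermionicCLM hp2 g‖ ≤ ‖g‖ := by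
  simpa using (fermionicCLM hp2).le_of_opNorm_le (LinearMap.mkContinuous_norm_le _ zero_le_one _) g

/-! ### Re-expansion of binomial series as power series -/

/-- The polynomial `∏_{j < n} (u - j - X)`. -/
noncomputable def shiftedDescPoly (u : ℂ_[p]) (n : ℕ) : Polynomial ℂ_[p] :=
  ∏ j ∈ Finset.range n, (Polynomial.C (u - j) - Polynomial.X)

theorem norm_coeff_shiftedDescPoly_le {u : ℂ_[p]} (hu : ‖u‖ ≤ 1) (n k : ℕ) :
    ‖(shiftedDescPoly u n).coeff k‖ ≤ 1 := by
  induction n generalizing k with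
  | zero =>
    rw [shiftedDescPoly, Finset.prod_range_zero, Polynomial.coeff_one]
    split_ifs <;> simp
  | succ n ih =>
    rw [shiftedDescPoly, Finset.prod_range_succ, ← shiftedDescPoly, mul_sub, Polynomial.coeff_sub,
      Polynomial.coeff_mul_C]
    refine norm_sub_le_of_norm_le ?_ ?_
    · rw [norm_mul]
      exact mul_le_one₀ (ih k) (norm_nonneg _) (norm_sub_le_of_norm_le hu (norm_natCast_le_one n))
    · cases k with
      | zero => simp
      | succ k => rw [Polynomial.coeff_mul_X]; exact ih k

theorem natDegree_shiftedDescPoly_le (u : ℂ_[p]) (n : ℕ) :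
    (shiftedDescPoly u n).natDegree ≤ n := by
  refine (Polynomial.natDegree_prod_le _ _).trans ?_
  refine (Finset.sum_le_card_nsmul _ _ 1 fun j _ => ?_).trans (by simp)
  exact (Polynomial.natDegree_sub_le _ _).trans
    (max_le ((Polynomial.natDegree_C _).trans_le zero_le_one) Polynomial.natDegree_X_le)

theorem eval_shiftedDescPoly (u h : ℂ_[p]) (n : ℕ) :
    (shiftedDescPoly u n).eval h = ∏ j ∈ Finset.range n, (u - h - j) := by
  rw [shiftedDescPoly, Polynomial.eval_prod]
  refine Finset.prod_congr rfl fun j _ => ?_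
  rw [Polynomial.eval_sub, Polynomial.eval_C, Polynomial.eval_X]
  ring

theorem norm_prod_sub_natCast_le_one {x : ℂ_[p]} (hx : ‖x‖ ≤ 1) (n : ℕ) :
    ‖∏ j ∈ Finset.range n, (x - j)‖ ≤ 1 := by
  rw [norm_prod]
  exact Finset.prod_le_one (fun _ _ => norm_nonneg _)
    fun j _ => norm_sub_le_of_norm_le hx (norm_natCast_le_one j)

/-- A binomial series with geometrically decaying coefficients is a power series around every
integral point, with geometrically decaying coefficients. -/
theorem exists_power_series {θ : ℝ} (h0 : 0 ≤ θ) (h1 : θ < 1) {β : ℕ → ℂ_[p]}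
    (hβ : ∀ n, ‖β n‖ ≤ θ ^ n) {u : ℂ_[p]} (hu : ‖u‖ ≤ 1) :
    ∃ (c : ℕ → ℂ_[p]) (φ C : ℝ), 0 ≤ φ ∧ φ < 1 ∧ (∀ k, ‖c k‖ ≤ C * φ ^ k) ∧
      ∀ h : ℂ_[p], ‖h‖ ≤ 1 →
        HasSum (fun k => c k * h ^ k) (∑' n, β n * ∏ j ∈ Finset.range n, (u - h - j)) := by
  -- The `k`-th coefficient of a degree-`n` term vanishes for `k > n`. For `k ≤ n`, `θ ^ n = φ ^ n *
  -- φ ^ n ≤ φ ^ n * φ ^ k`, so the double series is absolutely summable and may be rearranged.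
  set φ := Real.sqrt θ with hφ
  have hφ0 : 0 ≤ φ := Real.sqrt_nonneg θ
  have hφ1 : φ < 1 := by rw [hφ, Real.sqrt_lt' one_pos]; simpa using h1
  have hφθ : φ * φ = θ := Real.mul_self_sqrt h0
  have hgeo := summable_geometric_of_lt_one hφ0 hφ1
  have hbound : ∀ n k, ‖β n * (shiftedDescPoly u n).coeff k‖ ≤ φ ^ n * φ ^ k := by
    intro n k
    rcases le_or_gt k n with hkn | hkn
    · calc ‖β n * (shiftedDescPoly u n).coeff k‖ ≤ θ ^ n * 1 := by
            rw [norm_mul]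
            exact mul_le_mul (hβ n) (norm_coeff_shiftedDescPoly_le hu n k) (norm_nonneg _)
              (by positivity)
        _ = φ ^ n * φ ^ n := by rw [mul_one, ← mul_pow, hφθ]
        _ ≤ φ ^ n * φ ^ k := by
            exact mul_le_mul_of_nonneg_left (pow_le_pow_of_le_one hφ0 hφ1.le hkn) (by positivity)
    · rw [Polynomial.coeff_eq_zero_of_natDegree_lt
        ((natDegree_shiftedDescPoly_le u n).trans_lt hkn), mul_zero, norm_zero]
      positivity
  have hsum : Summable fun q : ℕ × ℕ => φ ^ q.1 * φ ^ q.2 :=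
    hgeo.mul_of_nonneg hgeo (fun _ => by positivity) (fun _ => by positivity)
  refine ⟨fun k => ∑' n, β n * (shiftedDescPoly u n).coeff k, φ, (1 - φ)⁻¹, hφ0, hφ1,
    fun k => ?_, fun h hh => ?_⟩
  · refine tsum_of_norm_bounded ?_ (fun n => hbound n k)
    exact (hasSum_geometric_of_lt_one hφ0 hφ1).mul_right _
  · set F : ℕ × ℕ → ℂ_[p] := fun q => β q.1 * (shiftedDescPoly u q.1).coeff q.2 * h ^ q.2 with hF
    have hFn : ∀ q, ‖F q‖ ≤ φ ^ q.1 * φ ^ q.2 := by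
      intro q
      rw [hF]
      simp only [norm_mul (_ * _), norm_pow]
      exact (mul_le_of_le_one_right (norm_nonneg _) (pow_le_one₀ (norm_nonneg _) hh)).trans
        (hbound q.1 q.2)
    have hFs : Summable F := Summable.of_norm_bounded hsum hFn
    have hrow : ∀ n, HasSum (fun k => F (n, k)) (β n * ∏ j ∈ Finset.range n, (u - h - j)) := by
      intro n
      rw [← eval_shiftedDescPoly, Polynomial.eval_eq_sum_range'
        (Nat.lt_succ_of_le (natDegree_shiftedDescPoly_le u n)), Finset.mul_sum]
      simp_rw [← mul_assoc]
      refine hasSum_sum_of_ne_finset_zero fun k hk => ?_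
      rw [Finset.mem_range, not_lt] at hk
      rw [hF]
      simp only
      rw [Polynomial.coeff_eq_zero_of_natDegree_lt
        ((natDegree_shiftedDescPoly_le u n).trans_lt hk), mul_zero, zero_mul]
    have htot : ∑' q, F q = ∑' n, β n * ∏ j ∈ Finset.range n, (u - h - j) :=
      (hFs.hasSum.prod_fiberwise hrow).tsum_eq.symm
    rw [← htot]
    have hswap : ∑' q : ℕ × ℕ, F q.swap = ∑' q, F q := (Equiv.prodComm ℕ ℕ).tsum_eq F
    have hsw : HasSum (fun q : ℕ × ℕ => F q.swap) (∑' q, F q) := hswap ▸ hFs.prod_symm.hasSum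
    refine hsw.prod_fiberwise fun k => ?_
    have hcol : Summable fun n => β n * (shiftedDescPoly u n).coeff k :=
      Summable.of_norm_bounded (hgeo.mul_right (φ ^ k)) fun n => hbound n k
    exact hcol.hasSum.mul_right (h ^ k)

/-- Consequences of a local expansion with geometrically decaying coefficients. -/
theorem contDiffAt_and_iteratedDeriv {f : ℂ_[p] → ℂ_[p]} {x : ℂ_[p]} {c : ℕ → ℂ_[p]} {φ C : ℝ}
    (h0 : 0 ≤ φ) (h1 : φ < 1) (hc : ∀ k, ‖c k‖ ≤ C * φ ^ k)
    (hf : ∀ h : ℂ_[p], ‖h‖ < 1 → HasSum (fun k => c k * h ^ k) (f (x + h))) :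
    ContDiffAt ℂ_[p] ((⊤ : ℕ∞) : WithTop ℕ∞) f x ∧
      ∀ k, iteratedDeriv k f x = k.factorial * c k := by
  have hps : HasFPowerSeriesOnBall f (FormalMultilinearSeries.ofScalars ℂ_[p] c) x 1 := by
    refine ⟨?_, one_pos, fun {y} hy => ?_⟩
    · have hC : 0 ≤ C := by simpa using (norm_nonneg _).trans (hc 0)
      have := FormalMultilinearSeries.le_radius_of_bound
        (FormalMultilinearSeries.ofScalars ℂ_[p] c) C (r := 1) fun n => by
          rw [FormalMultilinearSeries.ofScalars_norm, NNReal.coe_one, one_pow, mul_one]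
          exact (hc n).trans (mul_le_of_le_one_right hC (pow_le_one₀ h0 h1.le))
      simpa using this
    · rw [FormalMultilinearSeries.ofScalars_apply_eq']
      refine hf y ?_
      simpa [← enorm_eq_nnnorm, Metric.mem_eball, edist_zero_right, ← ofReal_norm] using hy
  refine ⟨hps.analyticAt.contDiffAt, fun k => ?_⟩
  -- By uniqueness of the expansion, the Taylor coefficients are the `c k`.
  have e := hps.analyticAt.hasFPowerSeriesAt.eq_formalMultilinearSeries hps.hasFPowerSeriesAt
  have e2 := congrFun (FormalMultilinearSeries.ofScalars_series_injective ℂ_[p] ℂ_[p] e) k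
  have hk : (k.factorial : ℂ_[p]) ≠ 0 := by exact_mod_cast k.factorial_ne_zero
  rw [← e2, mul_div_cancel₀ _ hk]

/-! ### Binomial series of continuous functions and the zeta function -/

theorem norm_binom_mul_le {ρ θ : ℝ} (hρ : 0 ≤ ρ)
    (hθ : ∀ n : ℕ, ρ ^ n / ‖(n.factorial : ℂ_[p])‖ ≤ θ ^ n) {x : ℂ_[p]} (hx : ‖x‖ ≤ 1) (n : ℕ) :
    ‖(∏ j ∈ Finset.range n, (x - (j : ℂ_[p]))) / (n.factorial : ℂ_[p])‖ * ρ ^ n ≤ θ ^ n := by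
  refine le_trans ?_ (hθ n)
  rw [norm_div, div_mul_eq_mul_div]
  gcongr
  exact mul_le_of_le_one_left (by positivity) (norm_prod_sub_natCast_le_one hx n)

/-- The binomial series `∑ binom(x, n) G ^ n` of continuous functions converges. -/
theorem summable_binom_smul_pow {ρ θ : ℝ} (hρ : 0 ≤ ρ) (h0 : 0 ≤ θ) (h1 : θ < 1)
    (hθ : ∀ n : ℕ, ρ ^ n / ‖(n.factorial : ℂ_[p])‖ ≤ θ ^ n) {x : ℂ_[p]} (hx : ‖x‖ ≤ 1)
    {G : C(ℤ_[p], ℂ_[p])} (hG : ‖G‖ ≤ ρ) :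
    Summable fun n : ℕ =>
      ((∏ j ∈ Finset.range n, (x - (j : ℂ_[p]))) / (n.factorial : ℂ_[p])) • G ^ n := by
  refine Summable.of_norm_bounded (summable_geometric_of_lt_one h0 h1) fun n => ?_
  refine le_trans ?_ (norm_binom_mul_le hρ hθ hx n)
  rw [norm_smul]
  gcongr
  exact (norm_pow_le G n).trans (by gcongr)

section

variable (ι : algebraicClosure ℚ ℂ →+* ℂ_[p]) {a : ℂ_[p]} {G : C(ℤ_[p], ℂ_[p])} {ρ θ : ℝ}

theorem hasSum_anglePowTerm (hGa : ∀ t, angle ι (a + ofZp t) - 1 = G t)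
    (hρ : 0 ≤ ρ) (h0 : 0 ≤ θ) (h1 : θ < 1)
    (hθ : ∀ n : ℕ, ρ ^ n / ‖(n.factorial : ℂ_[p])‖ ≤ θ ^ n) (hG : ‖G‖ ≤ ρ)
    {x : ℂ_[p]} (hx : ‖x‖ ≤ 1) (t : ℤ_[p]) :
    HasSum (anglePowTerm ι (a + ofZp t) x)
      ((∑' n : ℕ, ((∏ j ∈ Finset.range n, (x - (j : ℂ_[p]))) / (n.factorial : ℂ_[p])) • G ^ n) t) := by
  have h := (summable_binom_smul_pow hρ h0 h1 hθ hx hG).hasSum.mapL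
    (ContinuousMap.evalCLM ℂ_[p] t)
  refine h.congr_fun fun n => ?_
  rw [anglePowTerm, hGa]
  rfl

/-- The binomial series converges in the Banach space of continuous functions, so the integral and
evaluation at `t = 0`, which gives `⟨a⟩ ^ (1 - z)`, both apply termwise. -/
theorem zetaDefined_of_norm_le (hp2 : p ≠ 2) (hGa : ∀ t, angle ι (a + ofZp t) - 1 = G t)
    (hρ : 0 ≤ ρ) (h0 : 0 ≤ θ) (h1 : θ < 1)
    (hθ : ∀ n : ℕ, ρ ^ n / ‖(n.factorial : ℂ_[p])‖ ≤ θ ^ n) (hG : ‖G‖ ≤ ρ)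
    {z : ℂ_[p]} (hz : ‖z‖ ≤ 1) :
    ZetaDefined ι z a ∧ Summable (anglePowTerm ι a (1 - z)) ∧
      zeta ι z a - anglePow ι a (1 - z) =
        ∑' n : ℕ, (fermionicCLM hp2 (G ^ n) - G 0 ^ n) / (n.factorial : ℂ_[p]) *
          ∏ j ∈ Finset.range n, (1 - z - (j : ℂ_[p])) := by
  have hx : ‖1 - z‖ ≤ 1 := norm_sub_le_of_norm_le norm_one.le hz
  have hsum := hasSum_anglePowTerm ι hGa hρ h0 h1 hθ hG hx
  have hS := (summable_binom_smul_pow hρ h0 h1 hθ hx hG).hasSum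
  set F : C(ℤ_[p], ℂ_[p]) := ∑' n : ℕ, ((∏ j ∈ Finset.range n, (1 - z - (j : ℂ_[p]))) /
    (n.factorial : ℂ_[p])) • G ^ n
  have hF : (fun t : ℤ_[p] => anglePow ι (a + ofZp t) (1 - z)) = F :=
    funext fun t => (hsum t).tsum_eq
  have hsum0 : HasSum (anglePowTerm ι a (1 - z)) (F 0) := by
    have := hsum 0
    rwa [show ofZp (0 : ℤ_[p]) = 0 from norm_eq_zero.1 (by rw [norm_ofZp, norm_zero]),
      add_zero] at this
  refine ⟨⟨fun t => (hsum t).summable, ?_⟩, hsum0.summable, ?_⟩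
  · rw [hF]; exact exists_hasFermionicIntegral hp2 F.continuous
  · rw [zeta, hF, anglePow, hsum0.tsum_eq, ← fermionicCLM_apply hp2]
    refine (((hS.mapL (fermionicCLM hp2)).sub
      (hS.mapL (ContinuousMap.evalCLM ℂ_[p] (0 : ℤ_[p])))).congr_fun fun n => ?_).tsum_eq.symm
    rw [map_smul, map_smul, ← smul_sub, smul_eq_mul, div_mul_comm]
    rfl

end

/-- In small ramification `⟨a + t⟩ - 1` is a continuous function of `t ∈ ℤ_p`, small enough for
the binomial series to converge geometrically. -/
theorem exists_angle_add_ofZp_sub_one (ι : algebraicClosure ℚ ℂ →+* ℂ_[p])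
    (K : IntermediateField ℚ_[p] ℂ_[p]) [FiniteDimensional ℚ_[p] K]
    (hK : PadicEuler.ramificationIndex K < p - 1)
    (a : ℂ_[p]) (haK : a ∈ K) (ha : 1 < ‖a‖) :
    ∃ (G : C(ℤ_[p], ℂ_[p])) (ρ θ : ℝ), (∀ t, angle ι (a + ofZp t) - 1 = G t) ∧ 0 ≤ ρ ∧ 0 ≤ θ ∧
      θ < 1 ∧ (∀ n : ℕ, ρ ^ n / ‖(n.factorial : ℂ_[p])‖ ≤ θ ^ n) ∧ ‖G‖ ≤ ρ ∧
      ‖(omega ι a)⁻¹‖ ≤ ρ := by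
  have ha0 : a ≠ 0 := norm_pos_iff.1 (one_pos.trans ha)
  have he := ramificationIndex_ne_zero K
  obtain ⟨k, hk⟩ := exists_norm_pow_ramificationIndex haK ha0
  obtain ⟨hω, hy1, hye⟩ := omega_angle_spec ι (hK.trans_le (Nat.sub_le _ _)) haK ha0
  set e := ramificationIndex K with he_def
  have hωi : ‖(omega ι a)⁻¹‖ = ‖a⁻¹‖ := by rw [norm_inv, norm_inv, hω]
  have hai1 : ‖a⁻¹‖ < 1 := by rw [norm_inv]; exact inv_lt_one_of_one_lt₀ ha
  have haie : ‖a⁻¹‖ ^ e ≤ (p : ℝ)⁻¹ := norm_pow_ramificationIndex_le he (inv_mem haK) hai1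
  set ρ := max ‖angle ι a - 1‖ ‖(omega ι a)⁻¹‖ with hρ_def
  have hρ0 : 0 ≤ ρ := (norm_nonneg _).trans (le_max_left _ _)
  have hρ1 : ρ < 1 := max_lt hy1 (hωi ▸ hai1)
  have hρe : ρ ^ e ≤ (p : ℝ)⁻¹ := by
    rcases max_choice ‖angle ι a - 1‖ ‖(omega ι a)⁻¹‖ with h | h
    · rw [hρ_def, h]; exact hye
    · rw [hρ_def, h, hωi]; exact haie
  have hp1 : (1 : ℝ) < p := one_lt_prime_cast
  -- One factor `ρ ^ e` absorbs `p`; since `e < p - 1`, a positive power of `ρ` remains.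
  have hlt : p * ρ ^ (p - 1) < 1 := by
    calc p * ρ ^ (p - 1) = p * (ρ ^ e * ρ ^ (p - 1 - e)) := by
          rw [← pow_add, Nat.add_sub_cancel' hK.le]
      _ ≤ p * ((p : ℝ)⁻¹ * ρ ^ (p - 1 - e)) := by gcongr
      _ = ρ ^ (p - 1 - e) := by rw [mul_inv_cancel_left₀ (by positivity)]
      _ < 1 := pow_lt_one₀ hρ0 hρ1 (by omega)
  obtain ⟨θ, h0, h1, hθ⟩ := exists_pow_div_norm_factorial_le hρ0 hlt
  refine ⟨⟨fun t => (angle ι a - 1) + ofZp t / omega ι a, by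
    exact continuous_const.add (continuous_ofZp.div_const _)⟩, ρ, θ, fun t => ?_, hρ0, h0, h1, hθ,
    (ContinuousMap.norm_le _ hρ0).2 fun t => ?_, le_max_right _ _⟩
  · rw [angle_add ι he hk ((norm_ofZp_le_one t).trans_lt ha), add_sub_right_comm]
    rfl
  · refine norm_add_le_of_norm_le (le_max_left _ _) ?_
    rw [div_eq_mul_inv, norm_mul]
    exact (mul_le_of_le_one_left (norm_nonneg _) (norm_ofZp_le_one t)).trans (le_max_right _ _)

/-! ### Bounds for the operator and the main theorem -/

theorem norm_opCoeff_le (ι : algebraicClosure ℚ ℂ →+* ℂ_[p]) {a s : ℂ_[p]} {ρ θ : ℝ}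
    (hθ : ∀ n : ℕ, ρ ^ n / ‖(n.factorial : ℂ_[p])‖ ≤ θ ^ n)
    (hω : ‖(omega ι a)⁻¹‖ ≤ ρ) (hs : ‖s‖ ≤ 1) {n : ℕ} (hn : n ≠ 0) :
    ‖opCoeff ι a n s‖ ≤ θ ^ n := by
  have key : opCoeff ι a n s =
      (omega ι a)⁻¹ ^ n / n.factorial * ∏ j ∈ Finset.Icc 1 (n - 1), (s - 1 + (j : ℂ_[p])) := by
    rw [opCoeff, if_neg hn]
    split_ifs with h
    · subst h; simp
    · congr 1
      rw [inv_pow, one_div, mul_inv, div_eq_mul_inv, mul_comm]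
  have hprod : ‖∏ j ∈ Finset.Icc 1 (n - 1), (s - 1 + (j : ℂ_[p]))‖ ≤ 1 := by
    rw [norm_prod]
    exact Finset.prod_le_one (fun _ _ => norm_nonneg _) fun j _ =>
      norm_add_le_of_norm_le (norm_sub_le_of_norm_le hs norm_one.le) (norm_natCast_le_one j)
  rw [key, norm_mul]
  refine (mul_le_of_le_one_right (norm_nonneg _) hprod).trans (le_trans ?_ (hθ n))
  rw [norm_div, norm_pow]
  gcongr

/-- The factorials cancel, leaving the terms `c k * n ^ k`; since `|n| ≤ 1`, the bound does not
depend on `n`. -/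
theorem summable_expDTerm_and_norm_expD_le {f : ℂ_[p] → ℂ_[p]} {s : ℂ_[p]} {c : ℕ → ℂ_[p]}
    {φ C : ℝ} (h0 : 0 ≤ φ) (h1 : φ < 1) (hc : ∀ k, ‖c k‖ ≤ C * φ ^ k)
    (hf : ∀ k, iteratedDeriv k f s = k.factorial * c k) (n : ℕ) :
    Summable (expDTerm n f s) ∧ ‖expD n f s‖ ≤ C * (1 - φ)⁻¹ := by
  have hgeo := (hasSum_geometric_of_lt_one h0 h1).mul_left C
  have hb : ∀ k, ‖expDTerm n f s k‖ ≤ C * φ ^ k := by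
    intro k
    have hk : (k.factorial : ℂ_[p]) ≠ 0 := by exact_mod_cast k.factorial_ne_zero
    rw [expDTerm, hf, ← mul_assoc, div_mul_cancel₀ _ hk, norm_mul, norm_pow]
    exact (mul_le_of_le_one_left (norm_nonneg _)
      (pow_le_one₀ (norm_nonneg _) (norm_natCast_le_one n))).trans (hc k)
  exact ⟨Summable.of_norm_bounded hgeo.summable hb, tsum_of_norm_bounded hgeo hb⟩

end PadicEuler

theorem mainTheorem2 (p : ℕ) [Fact p.Prime] (hp : p ≠ 2)
    (ι : algebraicClosure ℚ ℂ →+* ℂ_[p])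
    (K : IntermediateField ℚ_[p] ℂ_[p]) [FiniteDimensional ℚ_[p] K]
    (hK : PadicEuler.ramificationIndex K < p - 1)
    (a : ℂ_[p]) (haK : a ∈ K) (ha : 1 < ‖a‖)
    (s : ℤ_[p]) (hs : s ≠ 1) :
    let s' : ℂ_[p] := PadicEuler.ofZp s
    let f : ℂ_[p] → ℂ_[p] :=
      fun z => PadicEuler.zeta ι z a - PadicEuler.anglePow ι a (1 - z)
    -- near `s` the function `f(z) = ζ_{p,E}(z, a) - ⟨a⟩ ^ (1 - z)` is given by convergent expressions
    (∀ᶠ z in 𝓝 s', PadicEuler.ZetaDefined ι z a ∧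
      Summable (PadicEuler.anglePowTerm ι a (1 - z))) ∧
    -- all its derivatives exist at `s`
    ContDiffAt ℂ_[p] ((⊤ : ℕ∞) : WithTop ℕ∞) f s' ∧
    -- for every `n` the series `exp_p(nD) f (s)` converges
    (∀ n : ℕ, Summable (PadicEuler.expDTerm n f s')) ∧
    -- the series `T_p^a f (s)` converges
    Summable (fun n : ℕ => PadicEuler.opCoeff ι a n s' * PadicEuler.expD n f s') := by
  intro s' f
  open PadicEuler in
  obtain ⟨G, ρ, θ, hGa, hρ, h0, h1, hθ, hG, hω⟩ := exists_angle_add_ofZp_sub_one ι K hK a haK ha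
  have hs1 : ‖s'‖ ≤ 1 := norm_ofZp_le_one s
  have hdef := fun {z : ℂ_[p]} (hz : ‖z‖ ≤ 1) =>
    zetaDefined_of_norm_le ι hp hGa hρ h0 h1 hθ hG hz
  have hβ : ∀ n : ℕ, ‖(fermionicCLM hp (G ^ n) - G 0 ^ n) / (n.factorial : ℂ_[p])‖ ≤ θ ^ n := by
    intro n
    have hGn : ‖G ^ n‖ ≤ ρ ^ n := (norm_pow_le G n).trans (by gcongr)
    refine le_trans ?_ (hθ n)
    rw [norm_div]
    gcongr
    exact norm_sub_le_of_norm_le ((norm_fermionicCLM_apply_le hp _).trans hGn)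
      (((G ^ n).norm_coe_le_norm 0).trans hGn)
  obtain ⟨c, φ, C, hφ0, hφ1, hc, hexp⟩ :=
    exists_power_series h0 h1 hβ (norm_sub_le_of_norm_le norm_one.le hs1 : ‖1 - s'‖ ≤ 1)
  have hf : ∀ h : ℂ_[p], ‖h‖ < 1 → HasSum (fun k => c k * h ^ k) (f (s' + h)) := by
    intro h hh
    have := hexp h hh.le
    rw [show f (s' + h) = _ from (hdef (norm_add_le_of_norm_le hs1 hh.le)).2.2]
    simpa only [sub_sub] using this
  obtain ⟨hcd, hder⟩ := contDiffAt_and_iteratedDeriv hφ0 hφ1 hc hf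
  have hexpD := summable_expDTerm_and_norm_expD_le hφ0 hφ1 hc hder
  refine ⟨?_, hcd, fun n => (hexpD n).1, ?_⟩
  · filter_upwards [Metric.ball_mem_nhds s' one_pos] with z hz
    rw [Metric.mem_ball, dist_eq_norm] at hz
    have hz1 : ‖z‖ ≤ 1 := by
      have := norm_add_le_of_norm_le hz.le hs1
      rwa [sub_add_cancel] at this
    exact ⟨(hdef hz1).1, (hdef hz1).2.1⟩
  -- The term `n = 0`, with coefficient `2 / (s - 1)`, escapes the geometric bound and is dropped.
  · rw [← summable_nat_add_iff 1]
    refine Summable.of_norm_bounded (((summable_nat_add_iff 1).2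
      (summable_geometric_of_lt_one h0 h1)).mul_right (C * (1 - φ)⁻¹)) fun n => ?_
    rw [norm_mul]
    exact mul_le_mul (norm_opCoeff_le ι hθ hω hs1 n.succ_ne_zero) (hexpD _).2 (norm_nonneg _)
      (by positivity)
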